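/- A lattice polytope $\mathcal{P}\subseteq\mathbb{R}^n$ is \emph{reflexive} if for some $u\in\mathbb{Z}^n$ the translate $\mathcal{P}'=\mathcal{P}-u$ has $0$ in its interior and its polar dual $\{y\in\mathbb{R}^n : x\cdot y\le 1 \text{ for all } x\in\mathcal{P}'\}$ is again a lattice polytope. It is \emph{integrally closed} if for every integer $m\ge 1$ each $x\in m\mathcal{P}\cap\mathbb{Z}^n$ is a sum of $m$ points of $\mathcal{P}\cap\mathbb{Z}^n$. For $d=\dim\mathcal{P}$, its $h^*$-vector $h^*(\mathcal{P})=(h_0^*,\dots,h_d^*)$ is defined by $$1+\sum_{m\ge 1}|m\mathcal{P}\cap\mathbb{Z}^n|\,t^m=\frac{\sum_{j=0}^d h_j^*t^j}{(1-t)^{d+1}},$$ and it is \emph{unimodal} if $h_0^*\le\cdots\le h_k^*\ge\cdots\ge h_d^*$ for some $0\le k\le d$. Let $\mathcal{P}\subseteq\mathbb{R}^n$ and $\mathcal{Q}\subseteq\mathbb{R}^m$ be integrally closed reflexive simplices with $0$ in the interior of $\mathcal{P}$, and let $v_0,\dots,v_m$ be the vertices of $\mathcal{Q}$. Then for each $i=0,\dots,m$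 the polytope $$\mathcal{P}*_i\mathcal{Q}:=\operatorname{conv}\bigl((\mathcal{P}\times 0^m)\cup(0^n\times(\mathcal{Q}-v_i))\bigr)\subseteq\mathbb{R}^{n+m}$$ is an integrally closed reflexive simplex. If, in addition, $h^*(\mathcal{P})$ and $h^*(\mathcal{Q})$ are unimodal, then $h^*(\mathcal{P}*_i\mathcal{Q})$ is unimodal. -/

import Mathlib

open scoped Pointwise

noncomputable section

namespace LatticePolytope

/-- The inclusion `ℤ^ι ⊆ ℝ^ι`. -/
def toReal {ι : Type*} (x : ι → ℤ) : ι → ℝ := fun i => (x i : ℝ)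

/-- A lattice polytope: the convex hull of a nonempty finite set of lattice points. -/
def IsLatticePolytope {ι : Type*} (P : Set (ι → ℝ)) : Prop :=
  ∃ s : Set (ι → ℤ), s.Finite ∧ s.Nonempty ∧ P = convexHull ℝ (toReal '' s)

/-- A simplex: the convex hull of a nonempty finite affinely independent family of points. -/
def IsSimplex {ι : Type*} (P : Set (ι → ℝ)) : Prop :=
  ∃ (k : ℕ) (v : Fin (k + 1) → ι → ℝ),
    AffineIndependent ℝ v ∧ P = convexHull ℝ (Set.range v)

/-- The translate `P - v`. -/
def translate {ι : Type*} (P : Set (ι → ℝ)) (v : ι → ℝ) : Set (ι → ℝ) :=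
  (fun x => x - v) '' P

/-- The polar dual `{y : x ⬝ y ≤ 1 for all x ∈ P}`. -/
def polarDual {ι : Type*} [Fintype ι] (P : Set (ι → ℝ)) : Set (ι → ℝ) :=
  {y | ∀ x ∈ P, x ⬝ᵥ y ≤ 1}

/-- A lattice polytope some lattice translate of which has `0` in its interior and has
a lattice polytope as its polar dual. -/
def IsReflexive {ι : Type*} [Fintype ι] (P : Set (ι → ℝ)) : Prop :=
  IsLatticePolytope P ∧
    ∃ u : ι → ℤ, 0 ∈ interior (translate P (toReal u)) ∧
      IsLatticePolytope (polarDual (translate P (toReal u)))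

/-- Every lattice point of the dilate `m P` is a sum of `m` lattice points of `P`. -/
def IsIntegrallyClosed {ι : Type*} (P : Set (ι → ℝ)) : Prop :=
  IsLatticePolytope P ∧
    ∀ m : ℕ, 0 < m → ∀ x : ι → ℤ, toReal x ∈ (m : ℝ) • P →
      ∃ y : Fin m → ι → ℤ, (∀ j, toReal (y j) ∈ P) ∧ x = ∑ j, y j

/-- The dimension of (the affine span of) `P`. -/
def dim {ι : Type*} (P : Set (ι → ℝ)) : ℕ := Module.finrank ℝ (vectorSpan ℝ P)

/-- The Ehrhart series `1 + ∑_{m ≥ 1} |m P ∩ ℤ^ι| t^m`. -/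
def ehrhartSeries {ι : Type*} (P : Set (ι → ℝ)) : PowerSeries ℤ :=
  PowerSeries.mk fun m =>
    if m = 0 then 1 else (Set.ncard {x : ι → ℤ | toReal x ∈ (m : ℝ) • P} : ℤ)

/-- The entry `h*_j` of the `h*`-vector: the coefficient of `t^j` in
`(1 - t)^(d + 1) E_P(t)`, with `d = dim P`; the `h*`-vector consists of the entries
with `0 ≤ j ≤ d`. -/
def hStar {ι : Type*} (P : Set (ι → ℝ)) (j : ℕ) : ℤ :=
  PowerSeries.coeff j ((1 - PowerSeries.X) ^ (dim P + 1) * ehrhartSeries P)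

/-- `h*_0 ≤ ⋯ ≤ h*_k ≥ ⋯ ≥ h*_d` for some `k`, where `d = dim P`. -/
def HStarUnimodal {ι : Type*} (P : Set (ι → ℝ)) : Prop :=
  ∃ k ≤ dim P, (∀ j < k, hStar P j ≤ hStar P (j + 1)) ∧
    ∀ j, k ≤ j → j < dim P → hStar P (j + 1) ≤ hStar P j

/-- For a vertex `v` of `Q`, the polytope `conv ((P × 0) ∪ (0 × (Q - v)))` in
`ℝ^ι × ℝ^κ = ℝ^(ι ⊕ κ)`. -/
def star {ι κ : Type*} (P : Set (ι → ℝ)) (Q : Set (κ → ℝ)) (v : κ → ℝ) :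
    Set (ι ⊕ κ → ℝ) :=
  convexHull ℝ (((fun x => Sum.elim x 0) '' P) ∪ ((fun y => Sum.elim 0 y) '' translate Q v))

end LatticePolytope

end

/-! Everything is read off the homogenised barycentric coordinates `hcoord b i x m`: they are
nonnegative exactly on the cone over the simplex, and the lattice points at height `j` with all
coordinates in `[0, 1)` number `h*_j` (`hStar_convexHull_range`). Reflexivity becomes arithmetic: at
the interior lattice point `u`, every coordinate of a lattice point at integer height is an integer
multiple of the corresponding coordinate of `(u, 1)` (`IsReflexiveCenter`). For `P` the point `u` is
`0`.

The star has the vertices `(b k, 0)` and `(0, c l - c i)` with `l ≠ i`. If `r` is the `i`-th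
coordinate of `(y, k)`, then `(x, y - k • c i)` at height `n + k` has the coordinates of `y` at
height `k` for `l ≠ i`, and those of `x` at height `n + r` on the `P` side. For `0 ≤ r < 1` the
extra height `r` adds less than one step of the discrete set of possible values, so it affects
neither nonnegativity nor being less than one (`IsReflexiveCenter.hcoord_add_height`). Choosing `k`
so that `r` lies in `[0, 1)` splits each lattice point of the cone over the star into one for `P`
and one for `Q`. This gives integral closure, and on boxes a bijection, so the `h*`-polynomial of
the star is the product of the two (`hStar_starBasis`).

The `h*`-vectors of reflexive simplices are symmetric, and a product of nonnegative symmetric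
unimodal sequences increases up to its middle (`IsSymmUnimodal.sum_antidiagonal_le_succ`); symmetry
of the star then gives the other half. -/

namespace LatticePolytope

/-! ### Homogenised barycentric coordinates and cones over simplices. -/

section Coordinates

variable {ι σ : Type*}

/-- The homogenised barycentric coordinate: the coefficient of `(b i, 1)` when `(x, m)` is
written as a linear combination of the vectors `(b j, 1)`. -/
noncomputable def hcoord (b : AffineBasis σ ℝ (ι → ℝ)) (i : σ) (x : ι → ℝ) (m : ℝ) : ℝ :=
  (b.coord i).linear x + m * b.coord i 0

variable (b : AffineBasis σ ℝ (ι → ℝ))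

lemma hcoord_add (i : σ) (x y : ι → ℝ) (m k : ℝ) :
    hcoord b i (x + y) (m + k) = hcoord b i x m + hcoord b i y k := by
  simp only [hcoord, map_add]; ring

lemma hcoord_smul (i : σ) (r : ℝ) (x : ι → ℝ) (m : ℝ) :
    hcoord b i (r • x) (r * m) = r * hcoord b i x m := by
  simp only [hcoord, map_smul, smul_eq_mul]; ring

lemma hcoord_sub (i : σ) (x y : ι → ℝ) (m k : ℝ) :
    hcoord b i (x - y) (m - k) = hcoord b i x m - hcoord b i y k := by
  simp only [hcoord, map_sub]; ring

lemma hcoord_zero (i : σ) : hcoord b i 0 0 = 0 := by simp [hcoord]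

lemma hcoord_one (i : σ) (x : ι → ℝ) : hcoord b i x 1 = b.coord i x := by
  have := (b.coord i).map_vadd 0 x
  simp only [vadd_eq_add, add_zero] at this
  rw [hcoord, this, one_mul]

lemma hcoord_height (i : σ) (x : ι → ℝ) (m k : ℝ) :
    hcoord b i x (m + k) = hcoord b i x m + k * hcoord b i 0 1 := by
  simp only [hcoord, map_zero]; ring

lemma hcoord_vertex_self (i : σ) : hcoord b i (b i) 1 = 1 := by
  rw [hcoord_one, b.coord_apply_eq]

lemma hcoord_vertex_ne {i j : σ} (h : i ≠ j) : hcoord b i (b j) 1 = 0 := by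
  rw [hcoord_one, b.coord_apply_ne h]

lemma hcoord_add_vertex_self (i : σ) (x : ι → ℝ) (m : ℝ) :
    hcoord b i (x + b i) (m + 1) = hcoord b i x m + 1 := by
  rw [hcoord_add, hcoord_vertex_self]

lemma hcoord_add_vertex_ne {i j : σ} (h : i ≠ j) (x : ι → ℝ) (m : ℝ) :
    hcoord b i (x + b j) (m + 1) = hcoord b i x m := by
  rw [hcoord_add, hcoord_vertex_ne b h, add_zero]

variable [Fintype σ]

lemma sum_linear_coord (x : ι → ℝ) : ∑ i, (b.coord i).linear x = 0 := by
  have h : ∀ i, (b.coord i).linear x = b.coord i x - b.coord i 0 := fun i => by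
    have := hcoord_one b i x
    rw [hcoord, one_mul] at this; linarith
  simp only [h, Finset.sum_sub_distrib, b.sum_coord_apply_eq_one, sub_self]

lemma sum_hcoord (x : ι → ℝ) (m : ℝ) : ∑ i, hcoord b i x m = m := by
  simp only [hcoord, Finset.sum_add_distrib, sum_linear_coord, ← Finset.mul_sum,
    b.sum_coord_apply_eq_one]; ring

lemma sum_linear_coord_smul (x : ι → ℝ) : ∑ i, (b.coord i).linear x • b i = x := by
  have h : ∀ i, (b.coord i).linear x = b.coord i x - b.coord i 0 := fun i => by
    have := hcoord_one b i x
    rw [hcoord, one_mul] at this; linarith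
  simp only [h, sub_smul, Finset.sum_sub_distrib, b.linear_combination_coord_eq_self, sub_zero]

lemma sum_hcoord_smul (x : ι → ℝ) (m : ℝ) : ∑ i, hcoord b i x m • b i = x := by
  simp only [hcoord, add_smul, mul_smul, Finset.sum_add_distrib, sum_linear_coord_smul,
    ← Finset.smul_sum, b.linear_combination_coord_eq_self, smul_zero, add_zero]

lemma hcoord_sum_smul (w : σ → ℝ) (i : σ) :
    hcoord b i (∑ j, w j • b j) (∑ j, w j) = w i := by
  classical
  have h : ∀ s : Finset σ, hcoord b i (∑ j ∈ s, w j • b j) (∑ j ∈ s, w j)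
      = ∑ j ∈ s, w j * hcoord b i (b j) 1 := by
    intro s
    induction s using Finset.induction_on with
    | empty => simp [hcoord_zero]
    | insert a s ha ih =>
      rw [Finset.sum_insert ha, Finset.sum_insert ha, Finset.sum_insert ha, hcoord_add, ih,
        ← hcoord_smul, mul_one]
  rw [h, Finset.sum_eq_single i]
  · rw [hcoord_vertex_self, mul_one]
  · intro j _ hj
    rw [hcoord_vertex_ne b hj.symm, mul_zero]
  · simp

/-- Homogenised coordinates are determined by the linear combination they express. -/
lemma hcoord_eq_of_sum {x : ι → ℝ} {m : ℝ} {w : σ → ℝ} (hm : ∑ j, w j = m)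
    (hx : ∑ j, w j • b j = x) (i : σ) : hcoord b i x m = w i := by
  rw [← hm, ← hx, hcoord_sum_smul]

lemma mem_smul_convexHull_iff (x : ι → ℝ) {m : ℝ} (hm : 0 ≤ m) :
    x ∈ m • convexHull ℝ (Set.range b) ↔ ∀ i, 0 ≤ hcoord b i x m := by
  rcases hm.eq_or_lt with rfl | hm
  · have hne : (convexHull ℝ (Set.range b)).Nonempty := by
      have := b.nonempty
      exact (Set.range_nonempty _).convexHull
    rw [Set.zero_smul_set hne, Set.mem_zero]
    refine ⟨fun h i => by rw [h, hcoord_zero], fun h => ?_⟩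
    have h0 : ∀ i ∈ Finset.univ, hcoord b i x 0 = 0 :=
      (Finset.sum_eq_zero_iff_of_nonneg fun i _ => h i).1 (sum_hcoord b x 0)
    rw [← sum_hcoord_smul b x 0]
    exact Finset.sum_eq_zero fun i hi => by rw [h0 i hi, zero_smul]
  · rw [Set.mem_smul_set_iff_inv_smul_mem₀ hm.ne', b.convexHull_eq_nonneg_coord, Set.mem_ofPred_eq]
    refine forall_congr' fun i => ?_
    have : hcoord b i x m = m * b.coord i (m⁻¹ • x) := by
      rw [← hcoord_one, ← hcoord_smul, smul_smul, mul_inv_cancel₀ hm.ne', one_smul, mul_one]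
    rw [this]
    exact (mul_nonneg_iff_of_pos_left hm).symm

lemma mem_convexHull_iff_hcoord (x : ι → ℝ) :
    x ∈ convexHull ℝ (Set.range b) ↔ ∀ i, 0 ≤ hcoord b i x 1 := by
  rw [← mem_smul_convexHull_iff b x zero_le_one, one_smul]

lemma vertex_mem_extremePoints (i : σ) :
    b i ∈ (convexHull ℝ (Set.range b)).extremePoints ℝ := by
  refine ⟨subset_convexHull ℝ _ ⟨i, rfl⟩, ?_⟩
  rintro y hy z hz ⟨r, s, hr, hs, hrs, h⟩
  rw [mem_convexHull_iff_hcoord] at hy hz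
  have key : ∀ j, j ≠ i → hcoord b j y 1 = 0 := by
    intro j hj
    have h1 : r * hcoord b j y 1 + s * hcoord b j z 1 = 0 := by
      rw [← hcoord_smul, ← hcoord_smul, ← hcoord_add, h, ← add_mul, hrs, one_mul,
        hcoord_vertex_ne b hj]
    have h2 := mul_nonneg hr.le (hy j)
    have h3 := mul_nonneg hs.le (hz j)
    have h4 : r * hcoord b j y 1 = 0 := by linarith
    exact (mul_eq_zero.1 h4).resolve_left hr.ne'
  have h1 : hcoord b i y 1 = 1 := by
    rw [← Finset.sum_eq_single (s := Finset.univ) (f := fun j => hcoord b j y 1) i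
      (fun j _ hj => key j hj) (by simp), sum_hcoord]
  rw [← sum_hcoord_smul b y 1, Finset.sum_eq_single i, h1, one_smul]
  · intro j _ hj; rw [key j hj, zero_smul]
  · simp

end Coordinates

/-! ### Full-dimensional lattice simplices as affine bases. -/

section Basis

variable {ι σ : Type*}

lemma mem_interior_convexHull_iff [Fintype ι] [Finite σ] (b : AffineBasis σ ℝ (ι → ℝ)) (x : ι → ℝ) :
    x ∈ interior (convexHull ℝ (Set.range b)) ↔ ∀ i, 0 < hcoord b i x 1 := by
  simp only [b.interior_convexHull, Set.mem_ofPred_eq, hcoord_one]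

lemma dim_convexHull_range [Fintype ι] (b : AffineBasis σ ℝ (ι → ℝ)) :
    dim (convexHull ℝ (Set.range b)) = Fintype.card ι := by
  rw [dim, ← direction_affineSpan, affineSpan_convexHull, b.tot, AffineSubspace.direction_top,
    finrank_top, Module.finrank_fintype_fun_eq_card]

/-- A simplex with nonempty interior that is a lattice polytope is spanned by an affine basis
of lattice points. -/
lemma exists_affineBasis_of_isSimplex [Fintype ι] {P : Set (ι → ℝ)} (hs : IsSimplex P)
    (hl : IsLatticePolytope P) (hi : (interior P).Nonempty) :
    ∃ (k : ℕ) (b : AffineBasis (Fin (k + 1)) ℝ (ι → ℝ)) (p : Fin (k + 1) → ι → ℤ),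
      P = convexHull ℝ (Set.range b) ∧ ∀ i, b i = toReal (p i) := by
  obtain ⟨k, v, hv, rfl⟩ := hs
  obtain ⟨s, -, -, hs⟩ := hl
  let b : AffineBasis (Fin (k + 1)) ℝ (ι → ℝ) :=
    ⟨v, hv, interior_convexHull_nonempty_iff_affineSpan_eq_top.1 hi⟩
  have hb : ∀ i, ∃ p : ι → ℤ, b i = toReal p := fun i => by
    -- An extreme point of a convex hull belongs to every generating set, in particular to the
    -- lattice one.
    have h : b i ∈ (convexHull ℝ (Set.range v)).extremePoints ℝ := vertex_mem_extremePoints b i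
    rw [hs] at h
    obtain ⟨p, -, hp⟩ := extremePoints_convexHull_subset h
    exact ⟨p, hp.symm⟩
  choose p hp using hb
  exact ⟨k, b, p, rfl, hp⟩

lemma isSimplex_convexHull_range [Fintype σ] (b : AffineBasis σ ℝ (ι → ℝ)) :
    IsSimplex (convexHull ℝ (Set.range b)) := by
  have := b.nonempty
  obtain ⟨k, hk⟩ := Nat.exists_eq_succ_of_ne_zero (Fintype.card_ne_zero (α := σ))
  let e : Fin (k + 1) ≃ σ := (Fintype.equivFinOfCardEq hk).symm
  refine ⟨k, b ∘ e, b.ind.comp_embedding e.toEmbedding, ?_⟩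
  rw [Set.range_comp, e.surjective.range_eq, Set.image_univ]

lemma isLatticePolytope_convexHull_range [Finite σ] [Nonempty σ] {b : σ → ι → ℝ}
    {p : σ → ι → ℤ} (hp : ∀ i, b i = toReal (p i)) :
    IsLatticePolytope (convexHull ℝ (Set.range b)) := by
  refine ⟨Set.range p, Set.finite_range p, Set.range_nonempty p, ?_⟩
  rw [← Set.range_comp]
  congr 2
  exact funext hp

end Basis

lemma toReal_add {ι : Type*} (x y : ι → ℤ) : toReal (x + y) = toReal x + toReal y := by
  ext i; simp [toReal]

lemma toReal_sub {ι : Type*} (x y : ι → ℤ) : toReal (x - y) = toReal x - toReal y := by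
  ext i; simp [toReal]

lemma toReal_zero {ι : Type*} : toReal (0 : ι → ℤ) = 0 := by
  ext i; simp [toReal]

lemma toReal_smul {ι : Type*} (n : ℤ) (x : ι → ℤ) : toReal (n • x) = (n : ℝ) • toReal x := by
  ext i; simp [toReal]

lemma toReal_injective {ι : Type*} : Function.Injective (toReal (ι := ι)) := fun x y h => by
  ext i; exact Int.cast_injective (congrFun h i)

/-! ### Reflexivity as an integrality condition on coordinates. -/

section Reflexive

variable {ι σ : Type*}

/-- The lattice point `u` is interior to the simplex with vertices `b`, and each homogenised
coordinate of each lattice point is an integer multiple of the one of `(u, 1)`; that is, `u` has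
lattice distance one from every facet. -/
def IsReflexiveCenter (b : AffineBasis σ ℝ (ι → ℝ)) (u : ι → ℤ) : Prop :=
  (∀ i, 0 < hcoord b i (toReal u) 1) ∧
    ∀ i (x : ι → ℤ) (m : ℤ), ∃ k : ℤ, hcoord b i (toReal x) m = k * hcoord b i (toReal u) 1

lemma mem_interior_translate_iff [Fintype ι] {P : Set (ι → ℝ)} {u : ι → ℝ} :
    0 ∈ interior (translate P u) ↔ u ∈ interior P := by
  have h : translate P u = Homeomorph.subRight u '' P := rfl
  rw [h, ← (Homeomorph.subRight u).image_interior]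
  constructor
  · rintro ⟨x, hx, h⟩
    have : x = u := sub_eq_zero.1 h
    rwa [← this]
  · exact fun h => ⟨u, h, sub_self u⟩

lemma sum_linear_coord_smul_sub [Fintype σ] (b : AffineBasis σ ℝ (ι → ℝ)) (x u : ι → ℝ) :
    ∑ l, (b.coord l).linear x • (b l - u) = x := by
  simp only [smul_sub, Finset.sum_sub_distrib, ← Finset.sum_smul, sum_linear_coord,
    sum_linear_coord_smul, zero_smul, sub_zero]

variable [Fintype ι]

lemma convex_polarDual (P : Set (ι → ℝ)) : Convex ℝ (polarDual P) := by
  intro y hy z hz r s hr hs hrs x hx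
  have h1 := mul_le_mul_of_nonneg_left (hy x hx) hr
  have h2 := mul_le_mul_of_nonneg_left (hz x hx) hs
  rw [dotProduct_add, dotProduct_smul, dotProduct_smul, smul_eq_mul, smul_eq_mul]
  linarith

/-- The vertex of the polar dual (with respect to the interior point `u`) that corresponds to the
facet opposite to the vertex `b i`. -/
noncomputable def dualVertex (b : AffineBasis σ ℝ (ι → ℝ)) (u : ι → ℝ) (i : σ) : ι → ℝ := by
  classical
  exact fun j => -(b.coord i).linear (Pi.single j 1) / hcoord b i u 1

lemma dotProduct_dualVertex (b : AffineBasis σ ℝ (ι → ℝ)) (u x : ι → ℝ) (i : σ) :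
    x ⬝ᵥ dualVertex b u i = -(b.coord i).linear x / hcoord b i u 1 := by
  classical
  conv_rhs => rw [pi_eq_sum_univ' x]
  rw [map_sum, ← Finset.sum_neg_distrib, Finset.sum_div, dotProduct]
  refine Finset.sum_congr rfl fun j _ => ?_
  rw [map_smul, smul_eq_mul, dualVertex]
  ring

lemma dotProduct_vertex_sub_dualVertex_ne (b : AffineBasis σ ℝ (ι → ℝ)) {u : ι → ℝ} {i l : σ}
    (hu : 0 < hcoord b i u 1) (h : i ≠ l) : (b l - u) ⬝ᵥ dualVertex b u i = 1 := by
  have h1 : hcoord b i (b l - u) (1 - 1) = - hcoord b i u 1 := by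
    rw [hcoord_sub, hcoord_vertex_ne b h, zero_sub]
  rw [sub_self, hcoord, zero_mul, add_zero] at h1
  rw [dotProduct_dualVertex, h1, neg_neg, div_self hu.ne']

lemma vertex_dotProduct_le_one (b : AffineBasis σ ℝ (ι → ℝ)) {u y : ι → ℝ} (l : σ)
    (hy : y ∈ polarDual (translate (convexHull ℝ (Set.range b)) u)) : (b l - u) ⬝ᵥ y ≤ 1 :=
  hy _ ⟨b l, subset_convexHull ℝ _ ⟨l, rfl⟩, rfl⟩

variable [Fintype σ]

lemma dotProduct_eq_sum_linear_coord (b : AffineBasis σ ℝ (ι → ℝ)) (x u y : ι → ℝ) :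
    x ⬝ᵥ y = ∑ l, (b.coord l).linear x * ((b l - u) ⬝ᵥ y) := by
  conv_lhs => rw [← sum_linear_coord_smul_sub b x u]
  simp only [sum_dotProduct, smul_dotProduct, smul_eq_mul]

lemma sum_hcoord_mul_dotProduct (b : AffineBasis σ ℝ (ι → ℝ)) (u y : ι → ℝ) :
    ∑ l, hcoord b l u 1 * ((b l - u) ⬝ᵥ y) = 0 := by
  have h : ∑ l, hcoord b l u 1 • (b l - u) = 0 := by
    simp only [smul_sub, Finset.sum_sub_distrib, ← Finset.sum_smul, sum_hcoord, sum_hcoord_smul,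
      one_smul, sub_self]
  simpa only [sum_dotProduct, smul_dotProduct, smul_eq_mul, zero_dotProduct]
    using congrArg (· ⬝ᵥ y) h

lemma dualVertex_mem_polarDual (b : AffineBasis σ ℝ (ι → ℝ)) {u : ι → ℝ} (i : σ)
    (hu : 0 < hcoord b i u 1) :
    dualVertex b u i ∈ polarDual (translate (convexHull ℝ (Set.range b)) u) := by
  rintro _ ⟨x, hx, rfl⟩
  rw [mem_convexHull_iff_hcoord] at hx
  have h1 : hcoord b i (x - u) (1 - 1) = hcoord b i x 1 - hcoord b i u 1 := hcoord_sub ..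
  rw [sub_self, hcoord, zero_mul, add_zero] at h1
  simp only
  rw [dotProduct_dualVertex, h1, div_le_one hu]
  linarith [hx i]

lemma polarDual_eq_convexHull_dualVertex (b : AffineBasis σ ℝ (ι → ℝ)) {u : ι → ℝ}
    (hu : ∀ i, 0 < hcoord b i u 1) :
    polarDual (translate (convexHull ℝ (Set.range b)) u)
      = convexHull ℝ (Set.range (dualVertex b u)) := by
  refine Set.Subset.antisymm (fun y hy => ?_) (convexHull_min ?_ (convex_polarDual _))
  · have hsum : ∑ l, hcoord b l u 1 * (1 - (b l - u) ⬝ᵥ y) = 1 := by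
      simp only [mul_sub, mul_one, Finset.sum_sub_distrib, sum_hcoord, sum_hcoord_mul_dotProduct,
        sub_zero]
    -- The weight of the `l`-th dual vertex is the slack of `y` at `b l`, scaled by the coordinate
    -- of `u`; nonnegativity of the weights is membership in the polar.
    have hy' : y = ∑ l, (hcoord b l u 1 * (1 - (b l - u) ⬝ᵥ y)) • dualVertex b u l := by
      refine dotProduct_eq _ _ fun x => ?_
      rw [dotProduct_comm, dotProduct_comm _ x, dotProduct_sum, dotProduct_eq_sum_linear_coord b x u]
      have h1 : ∀ l, x ⬝ᵥ (hcoord b l u 1 * (1 - (b l - u) ⬝ᵥ y)) • dualVertex b u l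
          = (b.coord l).linear x * ((b l - u) ⬝ᵥ y) - (b.coord l).linear x := fun l => by
        rw [dotProduct_smul, dotProduct_dualVertex, smul_eq_mul]
        have := (hu l).ne'
        field_simp
        ring
      simp only [h1, Finset.sum_sub_distrib, sum_linear_coord, sub_zero]
    rw [hy']
    exact (convex_convexHull ℝ _).sum_mem
      (fun l _ => mul_nonneg (hu l).le (sub_nonneg.2 (vertex_dotProduct_le_one b l hy))) hsum
      fun l _ => subset_convexHull ℝ _ ⟨l, rfl⟩
  · rintro _ ⟨i, rfl⟩
    exact dualVertex_mem_polarDual b i (hu i)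

/-- The inequalities at the vertices `b l`, `l ≠ i`, are tight here, hence tight at both ends of a
segment through this point. The relation `sum_hcoord_mul_dotProduct` then fixes the product with `b
i - u` as well. -/
lemma dualVertex_mem_extremePoints (b : AffineBasis σ ℝ (ι → ℝ)) {u : ι → ℝ}
    (hu : ∀ i, 0 < hcoord b i u 1) (i : σ) :
    dualVertex b u i ∈
      (polarDual (translate (convexHull ℝ (Set.range b)) u)).extremePoints ℝ := by
  classical
  refine ⟨dualVertex_mem_polarDual b i (hu i), ?_⟩
  rintro y hy z hz ⟨r, s, hr, hs, hrs, h⟩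
  have key : ∀ l, l ≠ i → (b l - u) ⬝ᵥ y = (b l - u) ⬝ᵥ dualVertex b u i := fun l hl => by
    have h1 := dotProduct_vertex_sub_dualVertex_ne b (hu i) hl.symm
    have h2 : r * ((b l - u) ⬝ᵥ y) + s * ((b l - u) ⬝ᵥ z) = 1 := by
      rw [← h1, ← h, dotProduct_add, dotProduct_smul, dotProduct_smul, smul_eq_mul, smul_eq_mul]
    have h3 := mul_le_mul_of_nonneg_left (vertex_dotProduct_le_one b l hz) hs.le
    have h4 := vertex_dotProduct_le_one b l hy
    have h5 : 1 ≤ (b l - u) ⬝ᵥ y := le_of_mul_le_mul_left (by linarith) hr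
    rw [h1]; exact le_antisymm h4 h5
  have key' : ∀ l, (b l - u) ⬝ᵥ y = (b l - u) ⬝ᵥ dualVertex b u i := fun l => by
    by_cases hl : l = i
    · subst hl
      have h1 := sum_hcoord_mul_dotProduct b u y
      have h2 := sum_hcoord_mul_dotProduct b u (dualVertex b u l)
      rw [← Finset.add_sum_erase _ _ (Finset.mem_univ l)] at h1 h2
      have h3 : ∑ k ∈ Finset.univ.erase l, hcoord b k u 1 * ((b k - u) ⬝ᵥ y)
          = ∑ k ∈ Finset.univ.erase l, hcoord b k u 1 * ((b k - u) ⬝ᵥ dualVertex b u l) :=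
        Finset.sum_congr rfl fun k hk => by rw [key k (Finset.ne_of_mem_erase hk)]
      exact mul_left_cancel₀ (hu l).ne' (by linarith)
    · exact key l hl
  refine dotProduct_eq _ _ fun x => ?_
  rw [dotProduct_comm, dotProduct_comm _ x, dotProduct_eq_sum_linear_coord b x u,
    dotProduct_eq_sum_linear_coord b x u]
  simp only [key']

/-- Dual vertices are extreme in a lattice polytope, hence lattice points `w`. The linear part of
the `i`-th coordinate is pairing with `-w`, scaled by the coordinate of `u`; evaluating at `u`
itself yields the constant term. -/
lemma exists_isReflexiveCenter (b : AffineBasis σ ℝ (ι → ℝ))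
    (h : IsReflexive (convexHull ℝ (Set.range b))) : ∃ u, IsReflexiveCenter b u := by
  obtain ⟨-, u, hu, s, -, -, hs⟩ := h
  rw [mem_interior_translate_iff, mem_interior_convexHull_iff] at hu
  refine ⟨u, hu, fun i x m => ?_⟩
  have hw := dualVertex_mem_extremePoints b hu i
  rw [hs] at hw
  obtain ⟨w, -, hw⟩ := extremePoints_convexHull_subset hw
  have hdot : ∀ z : ι → ℤ, (b.coord i).linear (toReal z)
      = -((z ⬝ᵥ w : ℤ) : ℝ) * hcoord b i (toReal u) 1 := fun z => by
    have h1 := dotProduct_dualVertex b (toReal u) (toReal z) i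
    rw [← hw, eq_div_iff (hu i).ne'] at h1
    have h2 : toReal z ⬝ᵥ toReal w = ((z ⬝ᵥ w : ℤ) : ℝ) := by simp [dotProduct, toReal]
    rw [h2] at h1
    linarith
  refine ⟨m * (1 + u ⬝ᵥ w) - x ⬝ᵥ w, ?_⟩
  have h3 : hcoord b i (toReal u) 1
      = -((u ⬝ᵥ w : ℤ) : ℝ) * hcoord b i (toReal u) 1 + 1 * b.coord i 0 := by
    rw [← hdot]; rfl
  have h4 : b.coord i 0 = hcoord b i (toReal u) 1 * (1 + ((u ⬝ᵥ w : ℤ) : ℝ)) := by linarith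
  rw [hcoord, hdot, h4]
  push_cast
  ring

lemma IsReflexiveCenter.isReflexive {b : AffineBasis σ ℝ (ι → ℝ)} {p : σ → ι → ℤ}
    (hp : ∀ i, b i = toReal (p i)) {u : ι → ℤ} (h : IsReflexiveCenter b u) :
    IsReflexive (convexHull ℝ (Set.range b)) := by
  classical
  have := b.nonempty
  refine ⟨isLatticePolytope_convexHull_range hp, u, ?_, ?_⟩
  · rw [mem_interior_translate_iff, mem_interior_convexHull_iff]; exact h.1
  · have hk : ∀ i j, ∃ k : ℤ, dualVertex b (toReal u) i j = k := fun i j => by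
      -- Height `0` isolates the linear part, whose value at a unit vector is an entry of the dual
      -- vertex up to sign and scale.
      obtain ⟨k, hk⟩ := h.2 i (Pi.single j 1) 0
      have h1 : toReal (Pi.single j 1 : ι → ℤ) = Pi.single j 1 := by
        ext l; by_cases hl : l = j
        · subst hl; simp [toReal]
        · simp [toReal, hl]
      rw [h1, hcoord, Int.cast_zero, zero_mul, add_zero] at hk
      refine ⟨-k, ?_⟩
      have h2 := dotProduct_dualVertex b (toReal u) (Pi.single j 1) i
      rw [single_one_dotProduct, hk] at h2
      rw [h2, Int.cast_neg, neg_div, mul_div_cancel_right₀ _ (h.1 i).ne']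
    choose w hw using hk
    rw [polarDual_eq_convexHull_dualVertex b h.1]
    exact isLatticePolytope_convexHull_range (p := w) fun i => funext fun j => hw i j

end Reflexive

/-! ### The `h*`-vector as a lattice point count, and its symmetry. -/

section Box

variable {ι σ : Type*}

/-- A positive integer multiple is at least the number itself, so `x` dominates `u` in every
coordinate; both coordinate families sum to one, which forces equality. -/
lemma IsReflexiveCenter.eq_of_pos [Fintype σ] {b : AffineBasis σ ℝ (ι → ℝ)} {u x : ι → ℤ}
    (h : IsReflexiveCenter b u) (hx : ∀ i, 0 < hcoord b i (toReal x) 1) : x = u := by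
  have hle : ∀ i ∈ Finset.univ, hcoord b i (toReal u) 1 ≤ hcoord b i (toReal x) 1 := fun i _ => by
    obtain ⟨k, hk⟩ := h.2 i x 1
    rw [Int.cast_one] at hk
    have hxi := hx i
    rw [hk] at hxi
    have hk0 : (0 : ℝ) < k := pos_of_mul_pos_left hxi (h.1 i).le
    have hk1 : (1 : ℝ) ≤ k := by exact_mod_cast (Int.cast_pos.1 hk0 : 0 < k)
    rw [hk]
    exact le_mul_of_one_le_left (h.1 i).le hk1
  have heq := (Finset.sum_eq_sum_iff_of_le hle).1 (by rw [sum_hcoord, sum_hcoord])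
  refine toReal_injective ?_
  rw [← sum_hcoord_smul b (toReal x) 1, ← sum_hcoord_smul b (toReal u) 1]
  exact Finset.sum_congr rfl fun i hi => by rw [heq i hi]

lemma finite_setOf_hcoord_nonneg [Finite ι] [Fintype σ] (b : AffineBasis σ ℝ (ι → ℝ)) (m : ℝ) :
    {x : ι → ℤ | ∀ i, 0 ≤ hcoord b i (toReal x) m}.Finite := by
  classical
  have := Fintype.ofFinite ι
  let C : ι → ℤ := fun j => ⌈∑ i, m * |b i j|⌉
  refine (Set.finite_Icc (-C) C).subset fun x hx => ?_
  have hxj : ∀ j, |x j| ≤ C j := fun j => by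
    have h1 : |(x j : ℝ)| ≤ ∑ i, m * |b i j| := by
      have h2 : (x j : ℝ) = ∑ i, hcoord b i (toReal x) m * b i j := by
        have := congrFun (sum_hcoord_smul b (toReal x) m) j
        simp only [Finset.sum_apply, Pi.smul_apply, smul_eq_mul] at this
        exact this.symm
      rw [h2]
      refine (Finset.abs_sum_le_sum_abs _ _).trans (Finset.sum_le_sum fun i _ => ?_)
      rw [abs_mul, abs_of_nonneg (hx i)]
      refine mul_le_mul_of_nonneg_right ?_ (abs_nonneg _)
      calc hcoord b i (toReal x) m ≤ ∑ k, hcoord b k (toReal x) m :=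
            Finset.single_le_sum (f := fun k => hcoord b k (toReal x) m)
              (fun k _ => hx k) (Finset.mem_univ i)
        _ = m := sum_hcoord ..
    have h3 : ((|x j| : ℤ) : ℝ) ≤ (C j : ℝ) := by
      rw [Int.cast_abs]; exact h1.trans (Int.le_ceil _)
    exact_mod_cast h3
  exact ⟨fun j => (abs_le.1 (hxj j)).1, fun j => (abs_le.1 (hxj j)).2⟩

/-- The lattice points of height `m` in the cone over the simplex whose coordinates with index
in `I` are less than one. -/
def partialBox (b : AffineBasis σ ℝ (ι → ℝ)) (I : Finset σ) (m : ℝ) : Set (ι → ℤ) :=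
  {x | (∀ i, 0 ≤ hcoord b i (toReal x) m) ∧ ∀ i ∈ I, hcoord b i (toReal x) m < 1}

/-- The lattice points of height `m` in the half-open fundamental parallelepiped. -/
def box (b : AffineBasis σ ℝ (ι → ℝ)) (m : ℝ) : Set (ι → ℤ) :=
  {x | ∀ i, 0 ≤ hcoord b i (toReal x) m ∧ hcoord b i (toReal x) m < 1}

lemma finite_partialBox [Finite ι] [Fintype σ] (b : AffineBasis σ ℝ (ι → ℝ)) (I : Finset σ)
    (m : ℝ) : (partialBox b I m).Finite :=
  (finite_setOf_hcoord_nonneg b m).subset fun _ hx => hx.1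

lemma finite_box [Finite ι] [Fintype σ] (b : AffineBasis σ ℝ (ι → ℝ)) (m : ℝ) :
    (box b m).Finite :=
  (finite_setOf_hcoord_nonneg b m).subset fun _ hx i => (hx i).1

lemma partialBox_univ [Fintype σ] (b : AffineBasis σ ℝ (ι → ℝ)) (m : ℝ) :
    partialBox b Finset.univ m = box b m := by
  ext x
  simp only [partialBox, box, Finset.mem_univ, true_implies, Set.mem_ofPred_eq, forall_and]

lemma partialBox_zero [Fintype σ] (b : AffineBasis σ ℝ (ι → ℝ)) (I : Finset σ) :
    partialBox b I 0 = {0} := by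
  ext x
  rw [Set.mem_singleton_iff]
  constructor
  · intro hx
    have h0 : ∀ i ∈ Finset.univ, hcoord b i (toReal x) 0 = 0 :=
      (Finset.sum_eq_zero_iff_of_nonneg fun i _ => hx.1 i).1 (sum_hcoord b _ 0)
    refine toReal_injective ?_
    rw [toReal_zero, ← sum_hcoord_smul b (toReal x) 0]
    exact Finset.sum_eq_zero fun i hi => by rw [h0 i hi, zero_smul]
  · rintro rfl
    simp [partialBox, toReal_zero, hcoord_zero]

/-- When the `i`-th coordinate is at least one, the vertex `p i` can be subtracted without leaving
the cone. Each vertex treated so accounts for one factor `1 - t`. -/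
lemma partialBox_succ [DecidableEq σ] {b : AffineBasis σ ℝ (ι → ℝ)} {p : σ → ι → ℤ}
    (hp : ∀ i, b i = toReal (p i)) {I : Finset σ} {i : σ} (hi : i ∉ I) (m : ℝ) :
    partialBox b I (m + 1)
      = partialBox b (insert i I) (m + 1) ∪ (· + p i) '' partialBox b I m := by
  ext x
  constructor
  · intro hx
    by_cases h : hcoord b i (toReal x) (m + 1) < 1
    · left
      refine ⟨hx.1, fun j hj => ?_⟩
      rcases Finset.mem_insert.1 hj with rfl | hj
      exacts [h, hx.2 j hj]
    · right
      have hx' : toReal x = toReal (x - p i) + b i := by rw [toReal_sub, hp, sub_add_cancel]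
      refine ⟨x - p i, ⟨fun j => ?_, fun j hj => ?_⟩, sub_add_cancel _ _⟩
      · by_cases hj : j = i
        · subst hj
          rw [hx', hcoord_add_vertex_self] at h
          linarith
        · rw [← hcoord_add_vertex_ne b hj, ← hx']; exact hx.1 j
      · have hji : j ≠ i := fun h => hi (h ▸ hj)
        rw [← hcoord_add_vertex_ne b hji, ← hx']; exact hx.2 j hj
  · rintro (hx | ⟨y, hy, rfl⟩)
    · exact ⟨hx.1, fun j hj => hx.2 j (Finset.mem_insert_of_mem hj)⟩
    · refine ⟨fun j => ?_, fun j hj => ?_⟩ <;> simp only [toReal_add, ← hp]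
      · by_cases hj : j = i
        · subst hj
          rw [hcoord_add_vertex_self]; linarith [hy.1 j]
        · rw [hcoord_add_vertex_ne b hj]; exact hy.1 j
      · have hji : j ≠ i := fun h => hi (h ▸ hj)
        rw [hcoord_add_vertex_ne b hji]; exact hy.2 j hj

lemma ncard_partialBox_succ [Finite ι] [Fintype σ] [DecidableEq σ]
    {b : AffineBasis σ ℝ (ι → ℝ)} {p : σ → ι → ℤ}
    (hp : ∀ i, b i = toReal (p i)) {I : Finset σ} {i : σ} (hi : i ∉ I) (m : ℝ) :
    (partialBox b I (m + 1)).ncard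
      = (partialBox b (insert i I) (m + 1)).ncard + (partialBox b I m).ncard := by
  rw [partialBox_succ hp hi, Set.ncard_union_eq _ (finite_partialBox ..)
    ((finite_partialBox ..).image _), Set.ncard_image_of_injective _ (add_left_injective _)]
  rw [Set.disjoint_left]
  rintro _ hx ⟨y, hy, rfl⟩
  have h1 := hx.2 i (Finset.mem_insert_self i I)
  simp only [toReal_add, ← hp] at h1
  rw [hcoord_add_vertex_self] at h1
  linarith [hy.1 i]

lemma one_sub_X_pow_mul_ehrhartSeries [Finite ι] [Fintype σ] {b : AffineBasis σ ℝ (ι → ℝ)}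
    {p : σ → ι → ℤ} (hp : ∀ i, b i = toReal (p i)) (I : Finset σ) :
    (1 - PowerSeries.X) ^ I.card * ehrhartSeries (convexHull ℝ (Set.range b))
      = PowerSeries.mk fun m : ℕ => ((partialBox b I m).ncard : ℤ) := by
  classical
  induction I using Finset.induction_on with
  | empty =>
    rw [Finset.card_empty, pow_zero, one_mul, ehrhartSeries]
    congr 1
    ext m
    split_ifs with hm
    · subst hm
      simp [partialBox_zero]
    · simp only [mem_smul_convexHull_iff b _ (Nat.cast_nonneg m)]
      simp [partialBox]
  | insert i I hi ih =>
    rw [Finset.card_insert_of_notMem hi, pow_succ', mul_assoc, ih]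
    ext m
    rw [sub_mul, one_mul, map_sub]
    cases m with
    | zero => simp [partialBox_zero]
    | succ m =>
      rw [PowerSeries.coeff_succ_X_mul]
      simp only [PowerSeries.coeff_mk]
      push_cast
      rw [ncard_partialBox_succ hp hi]
      push_cast
      ring

lemma hStar_convexHull_range [Fintype ι] [Fintype σ] {b : AffineBasis σ ℝ (ι → ℝ)}
    {p : σ → ι → ℤ} (hp : ∀ i, b i = toReal (p i)) (j : ℕ) :
    hStar (convexHull ℝ (Set.range b)) j = (box b j).ncard := by
  have hcard : dim (convexHull ℝ (Set.range b)) + 1 = (Finset.univ : Finset σ).card := by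
    rw [dim_convexHull_range, Finset.card_univ, b.card_eq_finrank_add_one,
      Module.finrank_fintype_fun_eq_card]
  rw [hStar, hcard, one_sub_X_pow_mul_ehrhartSeries hp, PowerSeries.coeff_mk, partialBox_univ]

lemma box_eq_empty [Fintype ι] [Fintype σ] (b : AffineBasis σ ℝ (ι → ℝ)) {j : ℕ}
    (hj : Fintype.card ι < j) : box b j = ∅ := by
  refine Set.eq_empty_iff_forall_notMem.2 fun x hx => ?_
  have := b.nonempty
  have h1 : ∑ i, hcoord b i (toReal x) j < ∑ _i : σ, (1 : ℝ) :=
    Finset.sum_lt_sum_of_nonempty Finset.univ_nonempty fun i _ => (hx i).2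
  rw [sum_hcoord, Finset.sum_const, Finset.card_univ, nsmul_one, Nat.cast_lt,
    b.card_eq_finrank_add_one, Module.finrank_fintype_fun_eq_card] at h1
  omega

lemma IsReflexiveCenter.exists_inv_eq {b : AffineBasis σ ℝ (ι → ℝ)}
    {p : σ → ι → ℤ} (hp : ∀ i, b i = toReal (p i)) {u : ι → ℤ} (h : IsReflexiveCenter b u)
    (i : σ) : ∃ N : ℤ, 1 = N * hcoord b i (toReal u) 1 := by
  obtain ⟨N, hN⟩ := h.2 i (p i) 1
  rw [Int.cast_one, ← hp, hcoord_vertex_self] at hN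
  exact ⟨N, hN⟩

/-- The number one is itself an integer multiple of the coordinate of `u`, so a smaller multiple is
smaller by at least a full step. -/
lemma IsReflexiveCenter.add_le_one {b : AffineBasis σ ℝ (ι → ℝ)}
    {p : σ → ι → ℤ} (hp : ∀ i, b i = toReal (p i)) {u : ι → ℤ} (h : IsReflexiveCenter b u)
    {i : σ} {x : ι → ℤ} {m : ℤ} (hx : hcoord b i (toReal x) m < 1) :
    hcoord b i (toReal x) m + hcoord b i (toReal u) 1 ≤ 1 := by
  obtain ⟨N, hN⟩ := h.exists_inv_eq hp i
  obtain ⟨k, hk⟩ := h.2 i x m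
  have hx : k * hcoord b i (toReal u) 1 < N * hcoord b i (toReal u) 1 := by rwa [← hk, ← hN]
  have hkN : (k : ℝ) < N := lt_of_mul_lt_mul_right hx (h.1 i).le
  have hkN' : (k : ℝ) + 1 ≤ N := by exact_mod_cast Int.cast_lt.1 hkN
  have := mul_le_mul_of_nonneg_right hkN' (h.1 i).le
  rw [hk]
  linarith

lemma IsReflexiveCenter.hcoord_add_height {b : AffineBasis σ ℝ (ι → ℝ)}
    {p : σ → ι → ℤ} (hp : ∀ i, b i = toReal (p i)) (h : IsReflexiveCenter b 0)
    (i : σ) (x : ι → ℤ) (a : ℤ) {r : ℝ} (hr0 : 0 ≤ r) (hr1 : r < 1) :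
    (0 ≤ hcoord b i (toReal x) (a + r) ↔ 0 ≤ hcoord b i (toReal x) a) ∧
      (hcoord b i (toReal x) (a + r) < 1 ↔ hcoord b i (toReal x) a < 1) := by
  have hl := h.1 i
  have hle := fun hx => h.add_le_one hp (i := i) (x := x) (m := a) hx
  obtain ⟨k, hk⟩ := h.2 i x a
  rw [toReal_zero] at hl hk hle
  rw [hcoord_height]
  refine ⟨⟨fun h1 => ?_, fun h1 => by positivity⟩, fun h1 => ?_, fun h1 => ?_⟩
  · rw [hk] at h1 ⊢
    rw [← add_mul] at h1
    have h2 : (0 : ℝ) ≤ k + r := nonneg_of_mul_nonneg_left h1 hl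
    have h3 : (-1 : ℝ) < k := by linarith
    have h4 : (-1 : ℤ) < k := by exact_mod_cast h3
    have h5 : (0 : ℝ) ≤ k := by exact_mod_cast (by omega : 0 ≤ k)
    positivity
  · nlinarith
  · nlinarith [hle h1]

/-- The vertex sum has all coordinates one at height `d + 1`, so the reflection turns a coordinate
`t` into `1 - t` minus that of `u`, which stays in `[0, 1)` by `add_le_one`. -/
lemma sum_vertices_sub_mem_box [Fintype ι] [Fintype σ] {b : AffineBasis σ ℝ (ι → ℝ)}
    {p : σ → ι → ℤ} (hp : ∀ i, b i = toReal (p i)) {u : ι → ℤ} (h : IsReflexiveCenter b u)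
    {j k : ℕ} (hjk : j + k = Fintype.card ι) {x : ι → ℤ} (hx : x ∈ box b j) :
    (∑ i, p i) - u - x ∈ box b k := by
  have hcard : Fintype.card σ = Fintype.card ι + 1 := by
    rw [b.card_eq_finrank_add_one, Module.finrank_fintype_fun_eq_card]
  intro i
  have hsum : hcoord b i (toReal (∑ i, p i)) (Fintype.card σ) = 1 := by
    have h1 := hcoord_sum_smul b (fun _ => 1) i
    simp only [one_smul, Finset.sum_const, Finset.card_univ, nsmul_one] at h1
    convert h1 using 2
    ext l; simp [toReal, hp]
  have hc : hcoord b i (toReal ((∑ i, p i) - u - x)) k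
      = 1 - hcoord b i (toReal u) 1 - hcoord b i (toReal x) j := by
    have hk : (k : ℝ) = Fintype.card σ - 1 - j := by
      rw [hcard, ← hjk]; push_cast; ring
    rw [hk, toReal_sub, toReal_sub, hcoord_sub, hcoord_sub, hsum]
  have h1 := h.add_le_one hp (i := i) (x := x) (m := j) (by simpa using (hx i).2)
  rw [Int.cast_natCast] at h1
  rw [hc]
  constructor
  · linarith
  · linarith [h.1 i, (hx i).1]

lemma ncard_box_symm [Fintype ι] [Fintype σ] {b : AffineBasis σ ℝ (ι → ℝ)}
    {p : σ → ι → ℤ} (hp : ∀ i, b i = toReal (p i)) {u : ι → ℤ} (h : IsReflexiveCenter b u)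
    {j k : ℕ} (hjk : j + k = Fintype.card ι) : (box b j).ncard = (box b k).ncard := by
  have hle : ∀ {j k : ℕ}, j + k = Fintype.card ι → (box b j).ncard ≤ (box b k).ncard :=
    fun hjk => Set.ncard_le_ncard_of_injOn (fun x => (∑ i, p i) - u - x)
      (fun x hx => sum_vertices_sub_mem_box hp h hjk hx)
      (fun x _ y _ hxy => sub_right_injective hxy) (finite_box b _)
  exact (hle hjk).antisymm (hle (by omega))

end Box

/-! ### The star simplex: coordinates, reflexivity, splitting of lattice points. -/

section Star

variable {ι κ σ τ : Type*}

lemma toReal_sumElim (x : ι → ℤ) (y : κ → ℤ) :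
    toReal (Sum.elim x y) = Sum.elim (toReal x) (toReal y) := by
  ext (i | i) <;> rfl

lemma IsIntegrallyClosed.exists_sum {P : Set (ι → ℝ)} (h : IsIntegrallyClosed P) {m : ℕ}
    {x : ι → ℤ} (hx : toReal x ∈ (m : ℝ) • P) :
    ∃ y : Fin m → ι → ℤ, (∀ j, toReal (y j) ∈ P) ∧ x = ∑ j, y j := by
  rcases m.eq_zero_or_pos with rfl | hm
  · refine ⟨0, fun j => j.elim0, toReal_injective ?_⟩
    obtain ⟨y, -, hy⟩ := hx
    simp only [Nat.cast_zero, zero_smul] at hy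
    simp [← hy, toReal_zero]
  · exact h.2 m hm x hx

lemma hcoord_sub_smul_vertex (c : AffineBasis τ ℝ (κ → ℝ)) (i : τ) (y : κ → ℝ) (m : ℝ) :
    hcoord c i (y - m • c i) 0 = hcoord c i y m - m := by
  have h : hcoord c i (m • c i) m = m := by
    have := hcoord_smul c i m (c i) 1
    rwa [hcoord_vertex_self, mul_one] at this
  have h' := hcoord_sub c i y (m • c i) m m
  rwa [sub_self, h] at h'

/-- The vertices of the star of two simplices with respect to the vertex `c i`. -/
noncomputable def starVertex (b : σ → ι → ℝ) (c : τ → κ → ℝ) (i : τ) :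
    σ ⊕ {l : τ // l ≠ i} → ι ⊕ κ → ℝ :=
  Sum.elim (fun k => Sum.elim (b k) 0) fun l => Sum.elim 0 (c l - c i)

/-- The `κ`-components see only the linearly independent differences `c l - c i`, so those weights
vanish first; the rest is a relation among the `b k`. -/
lemma affineIndependent_starVertex [Fintype σ] [Fintype τ] {b : σ → ι → ℝ} {c : τ → κ → ℝ}
    (hb : AffineIndependent ℝ b) (hc : AffineIndependent ℝ c) (i : τ) :
    AffineIndependent ℝ (starVertex b c i) := by
  classical
  rw [affineIndependent_iff_of_fintype] at hb ⊢
  rw [affineIndependent_iff_linearIndependent_vsub ℝ c i, Fintype.linearIndependent_iff] at hc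
  intro w hw0 hw
  rw [Finset.weightedVSub_eq_linear_combination _ hw0, Fintype.sum_sum_type] at hw
  rw [Fintype.sum_sum_type] at hw0
  have hr : ∀ l, w (Sum.inr l) = 0 := by
    refine hc (fun l => w (Sum.inr l)) ?_
    ext j
    simpa [starVertex] using congrFun hw (Sum.inr j)
  simp only [hr, Finset.sum_const_zero, add_zero, zero_smul] at hw0 hw
  have hl : ∀ k, w (Sum.inl k) = 0 := by
    refine hb (fun k => w (Sum.inl k)) hw0 ?_
    rw [Finset.weightedVSub_eq_linear_combination _ hw0]
    ext j
    simpa [starVertex] using congrFun hw (Sum.inl j)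
  rintro (k | l)
  exacts [hl k, hr l]

/-- The vertices of the star of two full-dimensional simplices form an affine basis. -/
noncomputable def starBasis [Fintype ι] [Fintype κ] [Fintype σ] [Fintype τ]
    (b : AffineBasis σ ℝ (ι → ℝ)) (c : AffineBasis τ ℝ (κ → ℝ)) (i : τ) :
    AffineBasis (σ ⊕ {l : τ // l ≠ i}) ℝ (ι ⊕ κ → ℝ) where
  toFun := starVertex b c i
  ind' := affineIndependent_starVertex b.ind c.ind i
  tot' := by
    classical
    rw [(affineIndependent_starVertex b.ind c.ind i).affineSpan_eq_top_iff_card_eq_finrank_add_one]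
    have hb := b.card_eq_finrank_add_one
    have hc := c.card_eq_finrank_add_one
    rw [Module.finrank_fintype_fun_eq_card] at hb hc ⊢
    have h : Fintype.card {l : τ // l ≠ i} = Fintype.card τ - 1 := by
      rw [Fintype.card_subtype_compl, Fintype.card_subtype_eq]
    rw [Fintype.card_sum, Fintype.card_sum, h]
    omega

variable [Fintype ι] [Fintype κ] [Fintype σ] [Fintype τ]
  (b : AffineBasis σ ℝ (ι → ℝ)) (c : AffineBasis τ ℝ (κ → ℝ)) (i : τ)

lemma starBasis_inl (k : σ) : starBasis b c i (Sum.inl k) = Sum.elim (b k) (0 : κ → ℝ) := rfl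

lemma starBasis_inr (l : {l : τ // l ≠ i}) :
    starBasis b c i (Sum.inr l) = Sum.elim (0 : ι → ℝ) (c l - c i) := rfl

lemma starBasis_eq_toReal {p : σ → ι → ℤ} (hp : ∀ k, b k = toReal (p k)) {q : τ → κ → ℤ}
    (hq : ∀ l, c l = toReal (q l)) (s : σ ⊕ {l : τ // l ≠ i}) :
    starBasis b c i s = toReal (Sum.elim (fun k => Sum.elim (p k) 0)
      (fun l : {l : τ // l ≠ i} => Sum.elim 0 (q l - q i)) s) := by
  rcases s with k | l
  · rw [starBasis_inl, Sum.elim_inl, toReal_sumElim, hp, toReal_zero]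
  · rw [starBasis_inr, Sum.elim_inr, toReal_sumElim, hq, hq, toReal_zero, toReal_sub]

variable [DecidableEq τ]

/-- At height `0` the coordinates of `y` sum to zero, so those with `l ≠ i` use up height `-hcoord c
i y 0`, and `x` receives the remainder. -/
lemma hcoord_starBasis (x : ι → ℝ) (y : κ → ℝ) (m : ℝ) (s : σ ⊕ {l : τ // l ≠ i}) :
    hcoord (starBasis b c i) s (Sum.elim x y) m
      = Sum.elim (fun k => hcoord b k x (m + hcoord c i y 0))
          (fun l : {l : τ // l ≠ i} => hcoord c l y 0) s := by
  classical
  refine hcoord_eq_of_sum _ ?_ ?_ s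
  · have h := sum_hcoord c y 0
    rw [Fintype.sum_eq_add_sum_subtype_ne _ i] at h
    simp only [Fintype.sum_sum_type, Sum.elim_inl, Sum.elim_inr, sum_hcoord]
    linarith
  · have h : ∑ l : {l : τ // l ≠ i}, hcoord c l y 0 • (c l - c i) = y := by
      have h1 := sum_linear_coord_smul_sub c y (c i)
      rw [Fintype.sum_eq_add_sum_subtype_ne _ i, sub_self, smul_zero, zero_add] at h1
      simpa only [hcoord, zero_mul, add_zero] using h1
    have h' := sum_hcoord_smul b x (m + hcoord c i y 0)
    simp only [Fintype.sum_sum_type, Sum.elim_inl, Sum.elim_inr, starBasis_inl, starBasis_inr]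
    ext (j | j)
    · simpa using congrFun h' j
    · simpa using congrFun h j

lemma hcoord_starBasis_inl (x : ι → ℝ) (y : κ → ℝ) (a m : ℝ) (k : σ) :
    hcoord (starBasis b c i) (Sum.inl k) (Sum.elim x (y - m • c i)) (a + m)
      = hcoord b k x (a + hcoord c i y m) := by
  rw [hcoord_starBasis, Sum.elim_inl, hcoord_sub_smul_vertex]
  congr 1; ring

lemma hcoord_starBasis_inr (x : ι → ℝ) (y : κ → ℝ) (a m : ℝ) (l : {l : τ // l ≠ i}) :
    hcoord (starBasis b c i) (Sum.inr l) (Sum.elim x (y - m • c i)) (a + m)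
      = hcoord c l y m := by
  have h := hcoord_sub c l y (m • c i) m (m * 1)
  rw [hcoord_smul, hcoord_vertex_ne c l.2, mul_one, sub_self, mul_zero, sub_zero] at h
  rw [hcoord_starBasis, Sum.elim_inr, h]

/-- The translated vertex `c i - c i` is the origin, which is redundant because it already lies in
`P`. -/
lemma star_eq_convexHull_starBasis (h0 : ∀ k, 0 ≤ hcoord b k 0 1) :
    star (convexHull ℝ (Set.range b)) (convexHull ℝ (Set.range c)) (c i)
      = convexHull ℝ (Set.range (starBasis b c i)) := by
  refine Set.Subset.antisymm (convexHull_min ?_ (convex_convexHull ℝ _)) (convexHull_mono ?_)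
  · rintro _ (⟨x, hx, rfl⟩ | ⟨_, ⟨y, hy, rfl⟩, rfl⟩)
    · rw [mem_convexHull_iff_hcoord] at hx ⊢
      rintro (k | l) <;> rw [hcoord_starBasis, hcoord_zero]
      · simpa using hx k
      · simp [hcoord_zero]
    · rw [mem_convexHull_iff_hcoord] at hy ⊢
      rintro (k | l)
      · have h := hcoord_starBasis_inl b c i 0 y 0 1 k
        rw [one_smul, zero_add, hcoord_height, hcoord_zero, zero_add] at h
        simp only [h]
        exact mul_nonneg (hy i) (h0 k)
      · have h := hcoord_starBasis_inr b c i 0 y 0 1 l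
        rw [one_smul, zero_add] at h
        simp only [h]
        exact hy l
  · rintro _ ⟨k | l, rfl⟩
    · exact Or.inl ⟨b k, subset_convexHull ℝ _ ⟨k, rfl⟩, rfl⟩
    · exact Or.inr ⟨c l - c i, ⟨c l, subset_convexHull ℝ _ ⟨l, rfl⟩, rfl⟩, rfl⟩

variable {b c}

lemma IsReflexiveCenter.starBasis {q : τ → κ → ℤ} (hq : ∀ l, c l = toReal (q l)) {u : κ → ℤ}
    (hb : IsReflexiveCenter b 0) (hc : IsReflexiveCenter c u) :
    IsReflexiveCenter (starBasis b c i) (Sum.elim 0 (u - q i)) := by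
  have hl : ∀ k, hcoord (LatticePolytope.starBasis b c i) (Sum.inl k)
      (toReal (Sum.elim 0 (u - q i))) 1 = hcoord c i (toReal u) 1 * hcoord b k 0 1 := fun k => by
    have h := hcoord_starBasis_inl b c i 0 (toReal u) 0 1 k
    rw [one_smul, zero_add, hcoord_height, hcoord_zero, zero_add] at h
    rw [toReal_sumElim, toReal_zero, toReal_sub, ← hq, h]
  have hr : ∀ l : {l : τ // l ≠ i}, hcoord (LatticePolytope.starBasis b c i) (Sum.inr l)
      (toReal (Sum.elim 0 (u - q i))) 1 = hcoord c l (toReal u) 1 := fun l => by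
    have h := hcoord_starBasis_inr b c i 0 (toReal u) 0 1 l
    rw [one_smul, zero_add] at h
    rw [toReal_sumElim, toReal_zero, toReal_sub, ← hq, h]
  constructor
  · rintro (k | l)
    · have := hb.1 k
      rw [toReal_zero] at this
      rw [hl]; exact mul_pos (hc.1 i) this
    · rw [hr]; exact hc.1 l
  · intro s z m
    obtain ⟨x, y, rfl⟩ : ∃ x y, z = Sum.elim x y :=
      ⟨z ∘ Sum.inl, z ∘ Sum.inr, (Sum.elim_comp_inl_inr z).symm⟩
    rw [toReal_sumElim]
    rcases s with k | l
    · obtain ⟨N, hN⟩ := hc.exists_inv_eq hq i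
      obtain ⟨n₁, h₁⟩ := hb.2 k x m
      obtain ⟨n₂, h₂⟩ := hc.2 i y 0
      rw [Int.cast_zero] at h₂
      -- The center's coordinate is a product of one from `Q` and one from `P`; `N` is the
      -- reciprocal of the `Q` factor.
      refine ⟨n₁ * N + n₂, ?_⟩
      rw [← toReal_sumElim] at *
      rw [hl, toReal_sumElim, hcoord_starBasis, Sum.elim_inl, hcoord_height, h₁, h₂, toReal_zero]
      push_cast
      linear_combination (n₁ * hcoord b k 0 1) * hN
    · obtain ⟨n, h⟩ := hc.2 l y 0
      rw [Int.cast_zero] at h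
      refine ⟨n, ?_⟩
      rw [hr, hcoord_starBasis, Sum.elim_inr, h]

variable {i}

/-- Each lattice point of the cone over the star splits into lattice points of the cones over
the two simplices. -/
lemma exists_split_of_hcoord_starBasis_nonneg {p : σ → ι → ℤ} (hp : ∀ k, b k = toReal (p k))
    {q : τ → κ → ℤ} (hq : ∀ l, c l = toReal (q l)) (hb : IsReflexiveCenter b 0) {m : ℕ}
    {z : ι ⊕ κ → ℤ} (hz : ∀ s, 0 ≤ hcoord (starBasis b c i) s (toReal z) m) :
    ∃ (n k : ℕ) (x : ι → ℤ) (y : κ → ℤ), n + k = m ∧ z = Sum.elim x (y - (k : ℤ) • q i) ∧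
      (∀ j, 0 ≤ hcoord b j (toReal x) n) ∧ (∀ j, 0 ≤ hcoord c j (toReal y) k) ∧
      hcoord c i (toReal y) k < 1 := by
  obtain ⟨x, y₀, rfl⟩ : ∃ x y, z = Sum.elim x y :=
    ⟨z ∘ Sum.inl, z ∘ Sum.inr, (Sum.elim_comp_inl_inr z).symm⟩
  -- Adding `q i` at height one raises the `i`-th coordinate by one; this is the unique number of
  -- copies that brings it into `[0, 1)`.
  set k : ℤ := ⌈-hcoord c i (toReal y₀) 0⌉ with hk
  set y : κ → ℤ := y₀ + k • q i with hy
  have hy₀ : toReal y₀ = toReal y - (k : ℝ) • c i := by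
    rw [hy, toReal_add, toReal_smul, hq, add_sub_cancel_right]
  have hri : hcoord c i (toReal y) k = hcoord c i (toReal y₀) 0 + k := by
    have h := hcoord_add c i (toReal y₀) ((k : ℝ) • c i) 0 (k * 1)
    rw [hcoord_smul, hcoord_vertex_self, mul_one, zero_add] at h
    rw [hy, toReal_add, toReal_smul, ← hq, h]
  have hr0 : 0 ≤ hcoord c i (toReal y) k := by
    rw [hri]; linarith [Int.le_ceil (-hcoord c i (toReal y₀) 0)]
  have hr1 : hcoord c i (toReal y) k < 1 := by
    rw [hri]; linarith [Int.ceil_lt_add_one (-hcoord c i (toReal y₀) 0)]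
  have hm : (m : ℝ) = ((m - k : ℤ) : ℝ) + k := by push_cast; ring
  rw [toReal_sumElim, hy₀, hm] at hz
  have hx : ∀ j, 0 ≤ hcoord b j (toReal x) ((m - k : ℤ) : ℝ) := fun j => by
    have h := hz (Sum.inl j)
    rw [hcoord_starBasis_inl] at h
    exact (hb.hcoord_add_height hp j x _ hr0 hr1).1.1 h
  have hyc : ∀ j, 0 ≤ hcoord c j (toReal y) k := fun j => by
    by_cases hj : j = i
    · rw [hj]; exact hr0
    · have h := hz (Sum.inr ⟨j, hj⟩)
      rwa [hcoord_starBasis_inr] at h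
  -- Both heights are sums of nonnegative coordinates.
  have hk0 : 0 ≤ k := by
    have h := Finset.sum_nonneg fun j (_ : j ∈ Finset.univ) => hyc j
    rw [sum_hcoord] at h
    exact_mod_cast h
  have hn0 : 0 ≤ (m : ℤ) - k := by
    have h := Finset.sum_nonneg fun j (_ : j ∈ Finset.univ) => hx j
    rw [sum_hcoord] at h
    exact_mod_cast h
  obtain ⟨k', hk'⟩ := Int.eq_ofNat_of_zero_le hk0
  obtain ⟨n, hn⟩ := Int.eq_ofNat_of_zero_le hn0
  rw [hn] at hx
  rw [hk'] at hyc hr1 hy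
  rw [Int.cast_natCast] at hx hyc hr1
  refine ⟨n, k', x, y, by omega, ?_, hx, hyc, hr1⟩
  rw [hy, add_sub_cancel_right]

lemma isIntegrallyClosed_starBasis {p : σ → ι → ℤ} (hp : ∀ k, b k = toReal (p k))
    {q : τ → κ → ℤ} (hq : ∀ l, c l = toReal (q l)) (hb : IsReflexiveCenter b 0)
    (hP : IsIntegrallyClosed (convexHull ℝ (Set.range b)))
    (hQ : IsIntegrallyClosed (convexHull ℝ (Set.range c))) :
    IsIntegrallyClosed (convexHull ℝ (Set.range (starBasis b c i))) := by
  have := (starBasis b c i).nonempty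
  refine ⟨isLatticePolytope_convexHull_range (starBasis_eq_toReal b c i hp hq), ?_⟩
  intro m _ z hz
  rw [mem_smul_convexHull_iff _ _ (Nat.cast_nonneg m)] at hz
  obtain ⟨n, k, x, y, rfl, rfl, hx, hy, -⟩ := exists_split_of_hcoord_starBasis_nonneg hp hq hb hz
  rw [← mem_smul_convexHull_iff _ _ (Nat.cast_nonneg _)] at hx hy
  obtain ⟨X, hX, rfl⟩ := hP.exists_sum hx
  obtain ⟨Y, hY, rfl⟩ := hQ.exists_sum hy
  have h0 : ∀ k, 0 ≤ hcoord b k 0 1 := fun k => by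
    have := hb.1 k
    rw [toReal_zero] at this
    exact this.le
  rw [← star_eq_convexHull_starBasis b c i h0]
  refine ⟨Fin.append (fun j => Sum.elim (X j) 0) fun j => Sum.elim 0 (Y j - q i), ?_, ?_⟩
  · refine Fin.addCases (fun j => ?_) fun j => ?_
    · rw [Fin.append_left, toReal_sumElim, toReal_zero]
      exact subset_convexHull ℝ _ (Or.inl ⟨_, hX j, rfl⟩)
    · rw [Fin.append_right, toReal_sumElim, toReal_zero, toReal_sub, ← hq]
      exact subset_convexHull ℝ _ (Or.inr ⟨_, ⟨_, hY j, rfl⟩, rfl⟩)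
  · rw [Fin.sum_univ_add]
    simp only [Fin.append_left, Fin.append_right]
    ext (j | j) <;> simp [Finset.sum_sub_distrib]

lemma sumElim_mem_box_starBasis {p : σ → ι → ℤ} (hp : ∀ k, b k = toReal (p k))
    {q : τ → κ → ℤ} (hq : ∀ l, c l = toReal (q l)) (hb : IsReflexiveCenter b 0) {n k : ℕ}
    {x : ι → ℤ} {y : κ → ℤ} (hy0 : 0 ≤ hcoord c i (toReal y) k)
    (hy1 : hcoord c i (toReal y) k < 1) :
    Sum.elim x (y - (k : ℤ) • q i) ∈ box (starBasis b c i) ((n + k : ℕ) : ℝ) ↔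
      x ∈ box b n ∧ y ∈ box c k := by
  have hz : toReal (Sum.elim x (y - (k : ℤ) • q i))
      = Sum.elim (toReal x) (toReal y - (k : ℝ) • c i) := by
    rw [toReal_sumElim, toReal_sub, toReal_smul, hq, Int.cast_natCast]
  have hl := fun j => hb.hcoord_add_height hp j x n hy0 hy1
  simp only [Int.cast_natCast] at hl
  simp only [box, Set.mem_ofPred_eq, hz, Nat.cast_add, Sum.forall, hcoord_starBasis_inl,
    hcoord_starBasis_inr, hl, Subtype.forall]
  refine and_congr_right fun _ => ⟨fun h j => ?_, fun h j _ => h j⟩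
  by_cases hj : j = i
  · rw [hj]; exact ⟨hy0, hy1⟩
  · exact h j hj

lemma ncard_box_starBasis {p : σ → ι → ℤ} (hp : ∀ k, b k = toReal (p k))
    {q : τ → κ → ℤ} (hq : ∀ l, c l = toReal (q l)) (hb : IsReflexiveCenter b 0) (m : ℕ) :
    (box (starBasis b c i) m).ncard
      = ∑ nk ∈ Finset.HasAntidiagonal.antidiagonal m, (box b nk.1).ncard * (box c nk.2).ncard := by
  classical
  let B : ℕ → Finset (ι → ℤ) := fun n => (finite_box b (n : ℝ)).toFinset
  let C : ℕ → Finset (κ → ℤ) := fun n => (finite_box c (n : ℝ)).toFinset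
  have hB : ∀ n : ℕ, (box b n).ncard = (B n).card := fun n => Set.ncard_eq_toFinset_card _ _
  have hC : ∀ n : ℕ, (box c n).ncard = (C n).card := fun n => Set.ncard_eq_toFinset_card _ _
  simp only [hB, hC, ← Finset.card_product]
  rw [← Finset.card_sigma, Set.ncard_eq_toFinset_card _ (finite_box _ _)]
  symm
  refine Finset.card_nbij (fun t => Sum.elim t.2.1 (t.2.2 - (t.1.2 : ℤ) • q i)) ?_ ?_ ?_
  · rintro ⟨⟨n, k⟩, x, y⟩ ht
    simp only [Finset.mem_coe, Finset.mem_sigma, Finset.HasAntidiagonal.mem_antidiagonal,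
      Finset.mem_product, B, C, Set.Finite.mem_toFinset] at ht
    obtain ⟨rfl, hx, hy⟩ := ht
    simp only [Finset.mem_coe, Set.Finite.mem_toFinset]
    exact (sumElim_mem_box_starBasis hp hq hb (hy i).1 (hy i).2).2 ⟨hx, hy⟩
  · rintro ⟨⟨n, k⟩, x, y⟩ ht ⟨⟨n', k'⟩, x', y'⟩ ht' heq
    simp only [Finset.mem_coe, Finset.mem_sigma, Finset.HasAntidiagonal.mem_antidiagonal,
      Finset.mem_product, B, C, Set.Finite.mem_toFinset] at ht ht'
    obtain ⟨hnk, hx, hy⟩ := ht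
    obtain ⟨hnk', hx', hy'⟩ := ht'
    obtain ⟨h1, h2⟩ := Sum.elim_eq_iff.1 heq
    -- The two coordinates lie in `[0, 1)`, so they cannot absorb a nonzero integer difference `k -
    -- k'`.
    have hc : hcoord c i (toReal y) k - k = hcoord c i (toReal y') k' - k' := by
      have h3 := congrArg toReal h2
      rw [toReal_sub, toReal_sub, toReal_smul, toReal_smul, ← hq, Int.cast_natCast,
        Int.cast_natCast] at h3
      rw [← hcoord_sub_smul_vertex, h3, hcoord_sub_smul_vertex]
    have hkk : k = k' := by
      have h4 : (k : ℝ) < k' + 1 := by linarith [(hy i).2, (hy' i).1]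
      have h5 : (k' : ℝ) < k + 1 := by linarith [(hy' i).2, (hy i).1]
      have h6 : k < k' + 1 := by exact_mod_cast h4
      have h7 : k' < k + 1 := by exact_mod_cast h5
      omega
    subst hkk
    obtain rfl : n = n' := by omega
    obtain rfl : x = x' := h1
    obtain rfl : y = y' := sub_left_injective h2
    rfl
  · intro z hz
    simp only [Finset.mem_coe, Set.Finite.mem_toFinset] at hz
    obtain ⟨n, k, x, y, rfl, rfl, -, hy, hy1⟩ :=
      exists_split_of_hcoord_starBasis_nonneg hp hq hb fun s => (hz s).1
    rw [sumElim_mem_box_starBasis hp hq hb (hy i) hy1] at hz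
    refine ⟨⟨(n, k), x, y⟩, ?_, rfl⟩
    simpa [B, C] using hz

end Star

/-! ### Convolution of symmetric unimodal sequences. -/

section Unimodal

/-- Extension of a sequence by zero to negative indices. -/
def extendZero (f : ℕ → ℤ) (i : ℤ) : ℤ := if 0 ≤ i then f i.toNat else 0

lemma extendZero_natCast (f : ℕ → ℤ) (i : ℕ) : extendZero f i = f i := by simp [extendZero]

lemma extendZero_of_neg (f : ℕ → ℤ) {i : ℤ} (hi : i < 0) : extendZero f i = 0 := by
  simp [extendZero, hi]

/-- The sequence is nonnegative, vanishes beyond `n`, is symmetric about `n / 2` and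
unimodal. -/
structure IsSymmUnimodal (f : ℕ → ℤ) (n : ℕ) : Prop where
  nonneg : ∀ j, 0 ≤ f j
  eq_zero : ∀ j, n < j → f j = 0
  symm : ∀ j k, j + k = n → f j = f k
  unimodal : ∃ k ≤ n, (∀ j < k, f j ≤ f (j + 1)) ∧ ∀ j, k ≤ j → j < n → f (j + 1) ≤ f j

variable {f g : ℕ → ℤ} {n m : ℕ}

lemma IsSymmUnimodal.le (hf : IsSymmUnimodal f n) {i j : ℕ} (hij : i ≤ j) (hn : i + j ≤ n) :
    f i ≤ f j := by
  obtain ⟨k, hk, hinc, hdec⟩ := hf.unimodal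
  have hinc' : ∀ d i, i + d ≤ k → f i ≤ f (i + d) := by
    intro d
    induction d with
    | zero => exact fun _ _ => le_rfl
    | succ d ih => exact fun i h => (ih i (by omega)).trans (hinc _ (by omega))
  have hdec' : ∀ d i, k ≤ i → i + d ≤ n → f (i + d) ≤ f i := by
    intro d
    induction d with
    | zero => exact fun _ _ _ => le_rfl
    | succ d ih => exact fun i h h' =>
        (hdec (i + d) (by omega) (by omega)).trans (ih i h (by omega))
  by_cases hjk : j ≤ k
  · have := hinc' (j - i) i (by omega)
    rwa [Nat.add_sub_cancel' hij] at this
  -- Past the peak, `i` is replaced by its mirror image `n - i ≥ j`.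
  · have := hdec' (n - i - j) j (by omega) (by omega)
    rwa [show j + (n - i - j) = n - i by omega, ← hf.symm i (n - i) (by omega)] at this

lemma IsSymmUnimodal.extendZero_le (hf : IsSymmUnimodal f n) {i j : ℤ} (hij : i ≤ j)
    (hn : i + j ≤ n) : extendZero f i ≤ extendZero f j := by
  by_cases hi : 0 ≤ i
  · simp only [extendZero, hi, hi.trans hij, if_true]
    exact hf.le (by omega) (by omega)
  · rw [extendZero_of_neg f (by omega)]
    simp only [extendZero]
    split_ifs
    exacts [hf.nonneg _, le_rfl]

lemma IsSymmUnimodal.extendZero_symm (hf : IsSymmUnimodal f n) {i j : ℤ} (hn : i + j = n) :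
    extendZero f i = extendZero f j := by
  have key : ∀ i j : ℤ, i + j = n → i < 0 → extendZero f i = extendZero f j := fun i j h hi => by
    rw [extendZero_of_neg f hi, extendZero, if_pos (by omega), hf.eq_zero _ (by omega)]
  rcases lt_or_ge i 0 with hi | hi
  · exact key i j hn hi
  rcases lt_or_ge j 0 with hj | hj
  · exact (key j i (by omega) hj).symm
  · simp only [extendZero, hi, hj, if_true]
    exact hf.symm _ _ (by omega)

lemma sum_antidiagonal_eq_sum_range (hg : ∀ j, m < j → g j = 0) (j : ℕ) :
    ∑ p ∈ Finset.HasAntidiagonal.antidiagonal j, f p.1 * g p.2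
      = ∑ k ∈ Finset.range (m + 1), extendZero f (j - k) * extendZero g k := by
  rw [← Finset.Nat.sum_antidiagonal_swap]
  simp only [Prod.fst_swap, Prod.snd_swap]
  rw [Finset.Nat.sum_antidiagonal_eq_sum_range_succ fun a b => f b * g a]
  have h1 : ∑ k ∈ Finset.range j.succ, f (j - k) * g k
      = ∑ k ∈ Finset.range j.succ, extendZero f (j - k) * extendZero g k :=
    Finset.sum_congr rfl fun k hk => by
      have : k ≤ j := by simpa [Nat.lt_succ_iff] using hk
      rw [← Nat.cast_sub this, extendZero_natCast, extendZero_natCast]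
  rw [h1]
  -- Both ranges embed in a common one; the added terms vanish through `f` at negative indices or
  -- through `g` beyond `m`.
  have h2 : ∀ s : ℕ, (s = j.succ ∨ s = m + 1) →
      ∑ k ∈ Finset.range s, extendZero f (j - k) * extendZero g k
        = ∑ k ∈ Finset.range (j + m + 1), extendZero f (j - k) * extendZero g k := by
    intro s hs
    refine Finset.sum_subset (Finset.range_subset_range.2 (by omega)) fun k _ hk => ?_
    rw [Finset.mem_range, not_lt] at hk
    rcases hs with rfl | rfl
    · rw [extendZero_of_neg f (by omega), zero_mul]
    · rw [extendZero_natCast g, hg k (by omega), mul_zero]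
  rw [h2 _ (Or.inl rfl), h2 _ (Or.inr rfl)]

/-- The increment is the sum of `F (j + 1 - k) * (G k - G (k - 1))`. The reflection `k ↦ m + 1 - k`
negates the difference of `G`, so averaging with the reflected sum yields products of two
differences, which have compatible signs on either side of the middle. -/
lemma IsSymmUnimodal.sum_antidiagonal_le_succ (hf : IsSymmUnimodal f n)
    (hg : IsSymmUnimodal g m) {j : ℕ} (hj : 2 * j + 1 ≤ n + m) :
    ∑ p ∈ Finset.HasAntidiagonal.antidiagonal j, f p.1 * g p.2
      ≤ ∑ p ∈ Finset.HasAntidiagonal.antidiagonal (j + 1), f p.1 * g p.2 := by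
  rw [sum_antidiagonal_eq_sum_range hg.eq_zero, sum_antidiagonal_eq_sum_range hg.eq_zero]
  set F := extendZero f
  set G := extendZero g
  have hsucc : ∑ k ∈ Finset.range (m + 1), F (((j + 1 : ℕ) : ℤ) - k) * G k
      = ∑ k ∈ Finset.range (m + 2), F (j + 1 - k) * G k := by
    have h0 : G ((m + 1 : ℕ) : ℤ) = 0 := by
      rw [show G = extendZero g from rfl, extendZero_natCast, hg.eq_zero _ (Nat.lt_succ_self m)]
    rw [Finset.sum_range_succ _ (m + 1), h0, mul_zero, add_zero]
    push_cast
    rfl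
  have hself : ∑ k ∈ Finset.range (m + 1), F ((j : ℤ) - k) * G k
      = ∑ k ∈ Finset.range (m + 2), F (j + 1 - k) * G (k - 1) := by
    have h0 : G (((0 : ℕ) : ℤ) - 1) = 0 := extendZero_of_neg g (by norm_num)
    rw [Finset.sum_range_succ' _ (m + 1), h0, mul_zero, add_zero]
    refine Finset.sum_congr rfl fun k _ => ?_
    congr 2 <;> push_cast <;> ring
  rw [hsucc, hself, ← sub_nonneg, ← Finset.sum_sub_distrib]
  simp only [← mul_sub]
  have hrefl : ∑ k ∈ Finset.range (m + 2), F (j + 1 - k) * (G k - G (k - 1))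
      = ∑ k ∈ Finset.range (m + 2), -(F (j - m + k) * (G k - G (k - 1))) := by
    rw [← Finset.sum_range_reflect]
    refine Finset.sum_congr rfl fun k hk => ?_
    have hk' : k ≤ m + 1 := by
      have := Finset.mem_range.1 hk
      omega
    have h1 : ((m + 2 - 1 - k : ℕ) : ℤ) = m + 1 - k := by omega
    have h2 : G (m + 1 - k) = G (k - 1) := hg.extendZero_symm (by ring)
    have h3 : G (m + 1 - k - 1) = G k := hg.extendZero_symm (by ring)
    rw [h1, h2, h3]
    ring_nf
  have htwo : 2 * ∑ k ∈ Finset.range (m + 2), F (j + 1 - k) * (G k - G (k - 1))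
      = ∑ k ∈ Finset.range (m + 2), (F (j + 1 - k) - F (j - m + k)) * (G k - G (k - 1)) := by
    rw [two_mul]
    nth_rewrite 2 [hrefl]
    rw [← Finset.sum_add_distrib]
    exact Finset.sum_congr rfl fun k _ => by ring
  have hnonneg : 0 ≤ ∑ k ∈ Finset.range (m + 2),
      (F (j + 1 - k) - F (j - m + k)) * (G k - G (k - 1)) := by
    refine Finset.sum_nonneg fun k _ => ?_
    rcases le_total (2 * k) (m + 1) with hk | hk
    · refine mul_nonneg (sub_nonneg.2 (hf.extendZero_le (by omega) (by omega))) (sub_nonneg.2 ?_)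
      rcases hk.eq_or_lt with hk | hk
      · exact (hg.extendZero_symm (by omega)).le
      · exact hg.extendZero_le (by omega) (by omega)
    · refine mul_nonneg_of_nonpos_of_nonpos
        (sub_nonpos.2 (hf.extendZero_le (by omega) (by omega))) (sub_nonpos.2 ?_)
      have h2 : G (m - k) = G k := hg.extendZero_symm (by ring)
      have h3 : G (m - k + 1) = G (k - 1) := hg.extendZero_symm (by ring)
      rw [← h2, ← h3]
      exact hg.extendZero_le (by omega) (by omega)
  linarith

end Unimodal

/-! ### Transfer to `h*`-vectors and conclusion. -/

section Final

variable {ι σ : Type*} [Fintype ι] [Fintype σ]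

lemma isSymmUnimodal_hStar {b : AffineBasis σ ℝ (ι → ℝ)} {p : σ → ι → ℤ}
    (hp : ∀ i, b i = toReal (p i)) {u : ι → ℤ} (h : IsReflexiveCenter b u)
    (hu : HStarUnimodal (convexHull ℝ (Set.range b))) :
    IsSymmUnimodal (fun j => hStar (convexHull ℝ (Set.range b)) j) (Fintype.card ι) := by
  rw [HStarUnimodal, dim_convexHull_range] at hu
  refine ⟨fun j => ?_, fun j hj => ?_, fun j k hjk => ?_, hu⟩ <;>
    simp only [hStar_convexHull_range hp]
  · exact Int.natCast_nonneg _
  · rw [box_eq_empty b hj, Set.ncard_empty, Nat.cast_zero]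
  · rw [ncard_box_symm hp h hjk]

/-- A nonnegative symmetric `h*`-vector that increases up to the middle is unimodal. -/
lemma hStarUnimodal_of_le_succ {b : AffineBasis σ ℝ (ι → ℝ)} {p : σ → ι → ℤ}
    (hp : ∀ i, b i = toReal (p i)) {u : ι → ℤ} (h : IsReflexiveCenter b u)
    (hle : ∀ j, 2 * j + 1 ≤ Fintype.card ι →
      hStar (convexHull ℝ (Set.range b)) j ≤ hStar (convexHull ℝ (Set.range b)) (j + 1)) :
    HStarUnimodal (convexHull ℝ (Set.range b)) := by
  rw [HStarUnimodal, dim_convexHull_range]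
  refine ⟨Fintype.card ι / 2, Nat.div_le_self _ _, fun j hj => hle j (by omega),
    fun j hj hj' => ?_⟩
  have hsymm : ∀ i k, i + k = Fintype.card ι →
      hStar (convexHull ℝ (Set.range b)) i = hStar (convexHull ℝ (Set.range b)) k :=
    fun i k hik => by simp only [hStar_convexHull_range hp, ncard_box_symm hp h hik]
  rw [hsymm (j + 1) (Fintype.card ι - j - 1) (by omega), hsymm j (Fintype.card ι - j - 1 + 1)
    (by omega)]
  exact hle _ (by omega)

lemma hStar_starBasis {κ τ : Type*} [Fintype κ] [Fintype τ] [DecidableEq τ]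
    {b : AffineBasis σ ℝ (ι → ℝ)} {c : AffineBasis τ ℝ (κ → ℝ)} {i : τ}
    {p : σ → ι → ℤ} (hp : ∀ k, b k = toReal (p k))
    {q : τ → κ → ℤ} (hq : ∀ l, c l = toReal (q l)) (hb : IsReflexiveCenter b 0) (m : ℕ) :
    hStar (convexHull ℝ (Set.range (starBasis b c i))) m
      = ∑ nk ∈ Finset.HasAntidiagonal.antidiagonal m,
          hStar (convexHull ℝ (Set.range b)) nk.1 * hStar (convexHull ℝ (Set.range c)) nk.2 := by
  simp only [hStar_convexHull_range hp, hStar_convexHull_range hq,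
    hStar_convexHull_range (starBasis_eq_toReal b c i hp hq), ncard_box_starBasis hp hq hb,
    Nat.cast_sum, Nat.cast_mul]

end Final

end LatticePolytope

theorem corollary2p6 {ι κ : Type*} [Fintype ι] [Fintype κ]
    (P : Set (ι → ℝ)) (Q : Set (κ → ℝ))
    (hP : LatticePolytope.IsSimplex P) (hQ : LatticePolytope.IsSimplex Q)
    (hPr : LatticePolytope.IsReflexive P) (hQr : LatticePolytope.IsReflexive Q)
    (hPc : LatticePolytope.IsIntegrallyClosed P) (hQc : LatticePolytope.IsIntegrallyClosed Q)
    (h0 : (0 : ι → ℝ) ∈ interior P)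
    (v : κ → ℝ) (hv : v ∈ Q.extremePoints ℝ) :
    (LatticePolytope.IsSimplex (LatticePolytope.star P Q v) ∧
      LatticePolytope.IsReflexive (LatticePolytope.star P Q v) ∧
      LatticePolytope.IsIntegrallyClosed (LatticePolytope.star P Q v)) ∧
    (LatticePolytope.HStarUnimodal P → LatticePolytope.HStarUnimodal Q →
      LatticePolytope.HStarUnimodal (LatticePolytope.star P Q v)) := by
  open LatticePolytope in
  obtain ⟨k, b, p, rfl, hp⟩ := exists_affineBasis_of_isSimplex hP hPr.1 ⟨0, h0⟩
  have hQi : (interior Q).Nonempty := by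
    obtain ⟨-, u, hu, -⟩ := hQr
    exact ⟨toReal u, mem_interior_translate_iff.1 hu⟩
  obtain ⟨l, c, q, rfl, hq⟩ := exists_affineBasis_of_isSimplex hQ hQr.1 hQi
  obtain ⟨i, rfl⟩ := extremePoints_convexHull_subset hv
  rw [mem_interior_convexHull_iff] at h0
  have hb : IsReflexiveCenter b 0 := by
    obtain ⟨u, hu⟩ := exists_isReflexiveCenter b hPr
    -- A reflexive center is the only interior lattice point, so here it is the origin.
    rwa [← hu.eq_of_pos (x := 0) (by rwa [toReal_zero])] at hu
  obtain ⟨u, hc⟩ := exists_isReflexiveCenter c hQr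
  have hs := hb.starBasis i hq hc
  have hpq := starBasis_eq_toReal b c i hp hq
  rw [star_eq_convexHull_starBasis b c i fun k => (h0 k).le]
  refine ⟨⟨isSimplex_convexHull_range _, hs.isReflexive hpq,
    isIntegrallyClosed_starBasis hp hq hb hPc hQc⟩, fun hPu hQu => ?_⟩
  refine hStarUnimodal_of_le_succ hpq hs fun j hj => ?_
  rw [hStar_starBasis hp hq hb, hStar_starBasis hp hq hb]
  rw [Fintype.card_sum] at hj
  exact (isSymmUnimodal_hStar hp hb hPu).sum_antidiagonal_le_succ (isSymmUnimodal_hStar hq hc hQu) hj
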